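/- Let $K\subset\mathbb{R}^2$ be a convex shape, that is, a compact convex set with non-empty interior, and let $\gamma$ be a rectifiable curve (a continuous curve $[a,b]\to\mathbb{R}^2$ of finite length) that passes through all extreme points of $K$. Then \[ \operatorname{length}\gamma \;\ge\; \operatorname{per}K-\operatorname{diam}K, \] where $\operatorname{per}K<\infty$ is the perimeter of $K$ (the length of its boundary $\partial K$), $\operatorname{diam}K$ is its diameter, and a point of $K$ is extreme if it lies on no open line segment with distinct end points in $K$. -/

import Mathlib

open scoped ENNReal

/-- The Euclidean plane. -/
abbrev Plane : Type := EuclideanSpace ℝ (Fin 2)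

/-- A convex shape: a compact convex subset of the plane with non-empty interior. -/
structure IsConvexShape (K : Set Plane) : Prop where
  isCompact : IsCompact K
  convex : Convex ℝ K
  nonempty_interior : (interior K).Nonempty

/-- The perimeter of a planar set: the one-dimensional Hausdorff measure (that is, the length)
of its boundary. Mathlib's normalization in dimension one (the sum of the diameters of the pieces
of a cover) gives a segment its usual length. -/
noncomputable def perimeter (K : Set Plane) : ℝ≥0∞ :=
  MeasureTheory.Measure.hausdorffMeasure 1 (frontier K)

/-- The length of the curve `γ : [a, b] → Plane`: the supremum of the lengths of its inscribed
polygonal lines. -/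
noncomputable def curveLength (γ : ℝ → Plane) (a b : ℝ) : ℝ≥0∞ :=
  eVariationOn γ (Set.Icc a b)

/-- `γ` restricted to `[a, b]` is a rectifiable curve: it is continuous and has finite length. -/
structure IsRectifiableCurve (γ : ℝ → Plane) (a b : ℝ) : Prop where
  le : a ≤ b
  continuousOn : ContinuousOn γ (Set.Icc a b)
  length_ne_top : curveLength γ a b ≠ ∞

/-! A discrete Cauchy–Crofton argument. Let `δ = π / M`, and let `h k` be the support function of
`K` at angle `k δ`. The polygon circumscribed about `K` with these `2M` normals has perimeter `2 tan
(δ/2) ∑ h k`, which bounds `per K` because the nearest-point map is nonexpanding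
(`perimeter_le_sum_edgeLength`, `sum_edgeLength`). On the curve, pick points of `K` that reach each
support line, order them by time and close the polygon by a chord. Its length is at most `Λ = length
γ + diam K`. Its projection in each direction covers the width of `K` at least twice, and averaging
over the directions gives `2 sin (δ/2) ∑ h k ≤ Λ` (`sum_supportAt_mul_sin_le`). Hence `per K ≤ Λ /
cos (δ/2)`; let `M → ∞`. -/

/-- The coordinate of `x` in the direction at angle `θ`. -/
noncomputable def coordAt (θ : ℝ) (x : Plane) : ℝ := x 0 * Real.cos θ + x 1 * Real.sin θ

lemma continuous_coordAt (θ : ℝ) : Continuous (coordAt θ) := by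
  unfold coordAt; fun_prop

lemma coordAt_add_pi (θ : ℝ) (x : Plane) : coordAt (θ + Real.pi) x = -coordAt θ x := by
  simp only [coordAt, Real.cos_add_pi, Real.sin_add_pi]; ring

lemma coordAt_sub (θ : ℝ) (x y : Plane) : coordAt θ (x - y) = coordAt θ x - coordAt θ y := by
  simp only [coordAt, PiLp.sub_apply]; ring

lemma coordAt_add_add_coordAt_sub (θ δ : ℝ) (x : Plane) :
    coordAt (θ + δ) x + coordAt (θ - δ) x = 2 * Real.cos δ * coordAt θ x := by
  simp only [coordAt, Real.cos_add, Real.sin_add, Real.cos_sub, Real.sin_sub]; ring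

lemma inner_plane (x y : Plane) : inner ℝ x y = x 0 * y 0 + x 1 * y 1 := by
  simp [PiLp.inner_apply, Fin.sum_univ_two, mul_comm]

lemma convex_coordAt_le (θ m : ℝ) : Convex ℝ {x | coordAt θ x ≤ m} := by
  intro x hx y hy s t hs ht hst
  simp only [Set.mem_ofPred_eq, coordAt, PiLp.add_apply, PiLp.smul_apply, smul_eq_mul] at *
  have h1 := mul_le_mul_of_nonneg_left hx hs
  have h2 := mul_le_mul_of_nonneg_left hy ht
  have : m = s * m + t * m := by rw [← add_mul, hst, one_mul]
  rw [this]
  linarith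

/-- Every vector is its length times a unit vector at some angle. -/
lemma exists_coordAt_eq_norm_mul_cos (x : Plane) :
    ∃ α, ∀ θ, coordAt θ x = ‖x‖ * Real.cos (α - θ) := by
  refine ⟨Complex.arg ⟨x 0, x 1⟩, fun θ => ?_⟩
  have hn : ‖x‖ = ‖(⟨x 0, x 1⟩ : ℂ)‖ := by
    rw [EuclideanSpace.norm_eq, Complex.norm_eq_sqrt_sq_add_sq]
    simp [Fin.sum_univ_two]
  have h0 := Complex.norm_mul_cos_arg ⟨x 0, x 1⟩
  have h1 := Complex.norm_mul_sin_arg ⟨x 0, x 1⟩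
  simp only at h0 h1
  rw [hn, Real.cos_sub, coordAt]
  linear_combination (-Real.cos θ) * h0 - Real.sin θ * h1

lemma Function.Periodic.sum_range_add {g : ℕ → ℝ} {N : ℕ} (hg : Function.Periodic g N) (m : ℕ) :
    ∑ k ∈ Finset.range N, g (k + m) = ∑ k ∈ Finset.range N, g k := by
  induction m with
  | zero => simp
  | succ m ih =>
    rw [← ih]
    have h1 := Finset.sum_range_succ' (fun k => g (k + m)) N
    rw [Finset.sum_range_succ] at h1
    have h2 := hg m
    simp only [zero_add] at h1
    rw [add_comm N m, h2] at h1
    have h3 : ∀ k, k + 1 + m = k + (m + 1) := fun k => by ring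
    simp only [h3] at h1
    linarith

/-! ### Closed walks on a line and averages of `|cos|` -/

/-- A closed polygonal walk on the line covers the distance between any two of its vertices at
least twice. -/
lemma two_mul_abs_sub_le_closed_sum (f : ℕ → ℝ) {n i j : ℕ} (hi : i ≤ n) (hj : j ≤ n) :
    2 * |f i - f j| ≤ ∑ l ∈ Finset.range n, |f (l + 1) - f l| + |f n - f 0| := by
  wlog hij : i ≤ j generalizing i j
  · rw [abs_sub_comm]; exact this hj hi (le_of_not_ge hij)
  have key : ∀ {p q : ℕ}, p ≤ q → |f q - f p| ≤ ∑ l ∈ Finset.Ico p q, |f (l + 1) - f l| := by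
    intro p q h
    have := dist_le_Ico_sum_dist f h
    simpa only [Real.dist_eq, abs_sub_comm] using this
  have h1 := key (Nat.zero_le i)
  have h2 := key hij
  have h3 := key hj
  have hs : ∑ l ∈ Finset.range n, |f (l + 1) - f l| = ∑ l ∈ Finset.Ico 0 i, |f (l + 1) - f l| +
      ∑ l ∈ Finset.Ico i j, |f (l + 1) - f l| + ∑ l ∈ Finset.Ico j n, |f (l + 1) - f l| := by
    rw [Finset.sum_Ico_consecutive _ (Nat.zero_le i) hij,
      Finset.sum_Ico_consecutive _ (Nat.zero_le j) hj, Finset.range_eq_Ico]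
  rw [hs]
  -- The second passage from `j` to `i` goes through `n` and the closing edge.
  have h4 : |f i - f j| ≤ |f i - f 0| + |f n - f 0| + |f n - f j| := by
    grind
  rw [abs_sub_comm (f j)] at h2
  linarith

lemma integral_abs_cos_zero_two_pi : ∫ x in (0 : ℝ)..(2 * Real.pi), |Real.cos x| = 4 := by
  have hp : Function.Periodic (fun x => |Real.cos x|) Real.pi := fun x => by
    simp [Real.cos_add_pi]
  have hi : ∀ a b, IntervalIntegrable (fun x => |Real.cos x|) MeasureTheory.volume a b :=
    fun a b => (by fun_prop : Continuous fun x => |Real.cos x|).intervalIntegrable a b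
  have h1 : ∫ x in (-(Real.pi / 2))..(-(Real.pi / 2) + Real.pi), |Real.cos x| = 2 := by
    have : -(Real.pi / 2) + Real.pi = Real.pi / 2 := by ring
    rw [this, intervalIntegral.integral_congr (g := Real.cos), integral_cos]
    · simp; norm_num
    · intro x hx
      rw [Set.uIcc_of_le (by linarith [Real.pi_pos])] at hx
      exact abs_of_nonneg (Real.cos_nonneg_of_mem_Icc hx)
  have h2 := hp.intervalIntegral_add_eq 0 (-(Real.pi / 2))
  have h3 := hp.intervalIntegral_add_eq Real.pi (-(Real.pi / 2))
  rw [← intervalIntegral.integral_add_adjacent_intervals (hi 0 Real.pi) (hi _ _)]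
  rw [zero_add] at h2
  rw [two_mul, h2, h3, h1]; norm_num

/-- The Riemann sums of `|cos|` over a full period, with steps `π / M`, are controlled by the
integral `4`. -/
lemma sum_abs_cos_mul_sin_le {M : ℕ} (hM : 1 ≤ M) (α : ℝ) :
    (∑ k ∈ Finset.range (2 * M), |Real.cos (α - k * (Real.pi / M))|) *
      Real.sin (Real.pi / M / 2) ≤ 2 := by
  set δ := Real.pi / M with hδ
  have hM0 : (0 : ℝ) < M := by exact_mod_cast hM
  have hδ0 : 0 < δ := by positivity
  have hδM : M * δ = Real.pi := by rw [hδ]; field_simp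
  have hδpi : δ ≤ Real.pi := by
    rw [hδ]; exact div_le_self Real.pi_pos.le (by exact_mod_cast hM)
  have hsin : 0 ≤ Real.sin (δ / 2) :=
    Real.sin_nonneg_of_nonneg_of_le_pi (by positivity) (by linarith)
  have hc : Continuous fun x => |Real.cos x| := by fun_prop
  -- Cells of width `δ` centred at `k δ - α`: the integral of `cos` over one is exactly its value at
  -- the centre times `2 sin (δ/2)`.
  let a : ℕ → ℝ := fun k => k * δ - α - δ / 2
  have hterm : ∀ k : ℕ, |Real.cos (α - k * δ)| * (2 * Real.sin (δ / 2)) ≤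
      ∫ x in (a k)..(a (k + 1)), |Real.cos x| := by
    intro k
    have hle : a k ≤ a (k + 1) := by simp only [a]; push_cast; linarith
    have h1 := intervalIntegral.abs_integral_le_integral_abs (f := Real.cos)
      (μ := MeasureTheory.volume) hle
    rw [integral_cos] at h1
    have h2 : a (k + 1) = k * δ - α + δ / 2 := by simp only [a]; push_cast; ring
    rw [← abs_of_nonneg (show 0 ≤ 2 * Real.sin (δ / 2) by positivity), ← abs_mul]
    have h3 : Real.sin (a (k + 1)) - Real.sin (a k) =
        Real.cos (α - k * δ) * (2 * Real.sin (δ / 2)) := by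
      rw [h2]
      simp only [a]
      rw [Real.sin_add, Real.sin_sub _ (δ / 2), ← neg_sub (k * δ) α, Real.cos_neg]
      ring
    rwa [h3] at h1
  have hsum := Finset.sum_le_sum fun k (_ : k ∈ Finset.range (2 * M)) => hterm k
  rw [intervalIntegral.sum_integral_adjacent_intervals fun k _ => hc.intervalIntegrable _ _,
    ← Finset.sum_mul] at hsum
  have hend : a (2 * M) = a 0 + 2 * Real.pi := by
    simp only [a]; push_cast; rw [← hδM]; ring
  have hp : Function.Periodic (fun x => |Real.cos x|) (2 * Real.pi) := fun x => by
    simp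
  have h4 := hp.intervalIntegral_add_eq (a 0) 0
  rw [zero_add, integral_abs_cos_zero_two_pi] at h4
  rw [hend, h4] at hsum
  linarith

/-- Discrete Crofton formula for a segment: its length controls the sum of its projections. -/
lemma sum_abs_coordAt_mul_sin_le {M : ℕ} (hM : 1 ≤ M) (x : Plane) :
    (∑ k ∈ Finset.range (2 * M), |coordAt (k * (Real.pi / M)) x|) *
      Real.sin (Real.pi / M / 2) ≤ 2 * ‖x‖ := by
  obtain ⟨α, hα⟩ := exists_coordAt_eq_norm_mul_cos x
  simp only [hα, abs_mul, abs_norm, ← Finset.mul_sum]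
  have := mul_le_mul_of_nonneg_left (sum_abs_cos_mul_sin_le hM α) (norm_nonneg x)
  linarith

/-- The points of a finite set of reals can be listed in increasing order. -/
lemma Finset.exists_monotone_enumeration {T : Finset ℝ} (hT : T.Nonempty) :
    ∃ (n : ℕ) (u : ℕ → ℝ), Monotone u ∧ (∀ i, u i ∈ T) ∧ ∀ t ∈ T, ∃ i ≤ n, u i = t := by
  obtain ⟨n, hn⟩ : ∃ n, T.card = n + 1 := ⟨T.card - 1, by have := hT.card_pos; omega⟩
  refine ⟨n, fun i => T.orderEmbOfFin hn ⟨min i n, by omega⟩, ?_, ?_, ?_⟩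
  · intro i j hij
    exact (T.orderEmbOfFin hn).monotone (by simp only [Fin.mk_le_mk]; omega)
  · exact fun i => T.orderEmbOfFin_mem hn _
  · intro t ht
    have : t ∈ Set.range (T.orderEmbOfFin hn) := by
      rw [Finset.range_orderEmbOfFin]; exact ht
    obtain ⟨i, rfl⟩ := this
    refine ⟨i, by omega, ?_⟩
    exact congrArg _ (Fin.ext (min_eq_left (by omega)))

/-! ### Support function and circumscribed polygon -/

/-- The support function of `K` in the direction at angle `θ`. -/
noncomputable def supportAt (K : Set Plane) (θ : ℝ) : ℝ := sSup (coordAt θ '' K)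

lemma supportAt_add_two_pi (K : Set Plane) (θ : ℝ) :
    supportAt K (θ + 2 * Real.pi) = supportAt K θ := by
  have : coordAt (θ + 2 * Real.pi) = coordAt θ := by
    ext x; simp [coordAt]
  rw [supportAt, this, supportAt]

lemma coordAt_le_supportAt {K : Set Plane} (hK : IsCompact K) (θ : ℝ) {x : Plane} (hx : x ∈ K) :
    coordAt θ x ≤ supportAt K θ :=
  le_csSup (hK.image (continuous_coordAt θ)).bddAbove ⟨x, hx, rfl⟩

lemma exists_coordAt_eq_supportAt {K : Set Plane} (hK : IsCompact K) (hne : K.Nonempty) (θ : ℝ) :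
    ∃ x ∈ K, coordAt θ x = supportAt K θ :=
  (hK.image (continuous_coordAt θ)).sSup_mem (hne.image _)

/-- The point at signed distance `s` from the foot of the perpendicular on the line whose
points have coordinate `h` in the direction at angle `θ`. -/
noncomputable def linePoint (θ h s : ℝ) : Plane :=
  !₂[h * Real.cos θ - s * Real.sin θ, h * Real.sin θ + s * Real.cos θ]

lemma isometry_linePoint (θ h : ℝ) : Isometry (linePoint θ h) := by
  refine Isometry.of_dist_eq fun s t => ?_
  rw [EuclideanSpace.dist_eq, Real.dist_eq, ← Real.sqrt_sq_eq_abs]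
  congr 1
  simp only [linePoint, Fin.sum_univ_two, Real.dist_eq, sq_abs]
  simp only [Matrix.cons_val_zero, Matrix.cons_val_one]
  linear_combination (s - t) ^ 2 * Real.sin_sq_add_cos_sq θ

lemma coordAt_linePoint (θ φ h s : ℝ) :
    coordAt φ (linePoint θ h s) = h * Real.cos (φ - θ) + s * Real.sin (φ - θ) := by
  simp only [coordAt, linePoint, Real.cos_sub, Real.sin_sub, Matrix.cons_val_zero,
    Matrix.cons_val_one]
  ring

lemma exists_linePoint_eq (θ : ℝ) (x : Plane) : ∃ s, linePoint θ (coordAt θ x) s = x := by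
  refine ⟨x 1 * Real.cos θ - x 0 * Real.sin θ, ?_⟩
  ext i
  fin_cases i <;> simp [linePoint, coordAt]
  · linear_combination x 0 * Real.sin_sq_add_cos_sq θ
  · linear_combination x 1 * Real.sin_sq_add_cos_sq θ

/-- The nearest-point map onto a compact convex set: it is nonexpanding, and it sends a point to
`y` as soon as `y` satisfies the variational inequality. -/
lemma exists_lipschitz_nearest_point {K : Set Plane} (hc : IsCompact K) (hconv : Convex ℝ K)
    (hne : K.Nonempty) : ∃ π : Plane → Plane, LipschitzWith 1 π ∧
      ∀ x, ∀ y ∈ K, (∀ w ∈ K, inner ℝ (x - y) (w - y) ≤ 0) → π x = y := by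
  have hex : ∀ x, ∃ v ∈ K, ∀ w ∈ K, inner ℝ (x - v) (w - v) ≤ 0 := by
    intro x
    obtain ⟨v, hv, h⟩ := exists_norm_eq_iInf_of_complete_convex hne hc.isComplete hconv x
    exact ⟨v, hv, (norm_eq_iInf_iff_real_inner_le_zero hconv hv).1 h⟩
  choose π hπK hπ using hex
  -- Add the two variational inequalities, then apply Cauchy–Schwarz. The case `x = y` also gives
  -- uniqueness of the nearest point.
  have key : ∀ x y v w : Plane, inner ℝ (x - v) (w - v) ≤ 0 → inner ℝ (y - w) (v - w) ≤ 0 →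
      dist v w ≤ dist x y := by
    intro x y v w h1 h2
    have h3 : inner ℝ (v - w) (v - w) ≤ inner ℝ (x - y) (v - w) := by
      have : inner ℝ (x - y) (v - w) - inner ℝ (v - w) (v - w) =
          -inner ℝ (x - v) (w - v) - inner ℝ (y - w) (v - w) := by
        simp only [inner_plane, PiLp.sub_apply]; ring
      linarith
    rw [real_inner_self_eq_norm_mul_norm] at h3
    have h4 := h3.trans (real_inner_le_norm _ _)
    rw [dist_eq_norm, dist_eq_norm]
    rcases (norm_nonneg (v - w)).eq_or_lt with h0 | h0
    · rw [← h0]; positivity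
    · exact le_of_mul_le_mul_right h4 h0
  refine ⟨π, ?_, ?_⟩
  · refine LipschitzWith.of_dist_le_mul fun x y => ?_
    rw [NNReal.coe_one, one_mul]
    exact key x y _ _ (hπ x _ (hπK y)) (hπ y _ (hπK x))
  · intro x y hy h
    have := key x x _ _ (hπ x y hy) (h _ (hπK x))
    rw [dist_self] at this
    exact dist_le_zero.1 this

/-- A frontier point of a convex set with interior points has an outer normal vector. -/
lemma exists_outer_normal {K : Set Plane} (hconv : Convex ℝ K) (hint : (interior K).Nonempty)
    {y : Plane} (hy : y ∈ frontier K) :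
    ∃ n : Plane, n ≠ 0 ∧ ∀ w ∈ K, inner ℝ n (w - y) ≤ 0 := by
  obtain ⟨f, hf⟩ := geometric_hahn_banach_open_point hconv.interior isOpen_interior hy.2
  refine ⟨(InnerProductSpace.toDual ℝ Plane).symm f, ?_, ?_⟩
  · intro h0
    have : f = 0 := by simpa using h0
    obtain ⟨z, hz⟩ := hint
    have := hf z hz
    simp_all
  · intro w hw
    rw [InnerProductSpace.toDual_symm_apply, map_sub, sub_nonpos]
    have hsub : closure (interior K) ⊆ {z | f z ≤ f y} :=
      closure_minimal (fun z hz => (hf z hz).le) (isClosed_le f.continuous continuous_const)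
    rw [hconv.closure_interior_eq_closure_of_nonempty_interior hint] at hsub
    exact hsub (subset_closure hw)

/-- The length of an edge of the polygon circumscribed about `K` with turning angle `δ`. -/
noncomputable def edgeLength (K : Set Plane) (θ δ : ℝ) : ℝ :=
  (supportAt K (θ + δ) + supportAt K (θ - δ) - 2 * Real.cos δ * supportAt K θ) / Real.sin δ

lemma edgeLength_nonneg {K : Set Plane} (hK : IsCompact K) (hne : K.Nonempty) (θ : ℝ) {δ : ℝ}
    (hδ : 0 < Real.sin δ) : 0 ≤ edgeLength K θ δ := by
  obtain ⟨x, hx, hxθ⟩ := exists_coordAt_eq_supportAt hK hne θ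
  have h1 := coordAt_le_supportAt hK (θ + δ) hx
  have h2 := coordAt_le_supportAt hK (θ - δ) hx
  have h3 := coordAt_add_add_coordAt_sub θ δ x
  rw [hxθ] at h3
  exact div_nonneg (by linarith) hδ.le

/-- A nonzero vector has a positive coordinate in one of the directions `k π / M`, `k < 2M`. -/
lemma exists_coordAt_pos {M : ℕ} (hM : 2 ≤ M) {n : Plane} (hn : n ≠ 0) :
    ∃ k ∈ Finset.range (2 * M), 0 < coordAt (k * (Real.pi / M)) n := by
  by_contra! h
  have hM0 : (0 : ℝ) < M := by positivity
  -- Opposite directions force the coordinates to vanish; directions `0` and `1` are independent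
  -- since `M ≥ 2`.
  have hop : ∀ k < M, coordAt (k * (Real.pi / M)) n = 0 := by
    intro k hk
    have h1 := h k (by simp; omega)
    have h2 := h (k + M) (by simp; omega)
    have : ((k + M : ℕ) : ℝ) * (Real.pi / M) = k * (Real.pi / M) + Real.pi := by
      push_cast; field_simp
    rw [this, coordAt_add_pi] at h2
    linarith
  have h0 := hop 0 (by omega)
  have h1 := hop 1 (by omega)
  have hsin : 0 < Real.sin (Real.pi / M) := by
    apply Real.sin_pos_of_pos_of_lt_pi (by positivity)
    exact div_lt_self Real.pi_pos (by exact_mod_cast hM)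
  simp [coordAt] at h0 h1
  rw [h0] at h1
  apply hn
  ext i
  fin_cases i
  · simpa using h0
  · simpa [hsin.ne'] using h1

/-- The frontier of `K` is the image, under the nearest-point map, of the edges of a circumscribed
polygon, so that its length is at most the perimeter of that polygon. -/
lemma perimeter_le_sum_edgeLength {K : Set Plane} (hK : IsConvexShape K) {M : ℕ} (hM : 2 ≤ M) :
    perimeter K ≤ ∑ k ∈ Finset.range (2 * M),
      ENNReal.ofReal (edgeLength K (k * (Real.pi / M)) (Real.pi / M)) := by
  have hne : K.Nonempty := hK.nonempty_interior.mono interior_subset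
  have hc := hK.isCompact
  obtain ⟨p, hpL, hp⟩ := exists_lipschitz_nearest_point hc hK.convex hne
  set δ := Real.pi / M with hδ
  have hM0 : (0 : ℝ) < M := by positivity
  have hδM : M * δ = Real.pi := by rw [hδ]; field_simp
  have hsin : 0 < Real.sin δ := by
    apply Real.sin_pos_of_pos_of_lt_pi (by positivity)
    exact div_lt_self Real.pi_pos (by exact_mod_cast hM)
  let θ : ℕ → ℝ := fun k => k * δ
  let h : ℕ → ℝ := fun k => supportAt K (θ k)
  -- The edge ends where the `k`-th support line meets its two neighbours.
  let lo : ℕ → ℝ := fun k => (Real.cos δ * h k - supportAt K (θ k - δ)) / Real.sin δ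
  let hi : ℕ → ℝ := fun k => (supportAt K (θ k + δ) - Real.cos δ * h k) / Real.sin δ
  have hcover : frontier K ⊆
      ⋃ k ∈ Finset.range (2 * M), (p ∘ linePoint (θ k) (h k)) '' Set.Icc (lo k) (hi k) := by
    intro y hy
    have hyK : y ∈ K := hc.isClosed.frontier_subset hy
    obtain ⟨n, hn0, hn⟩ := exists_outer_normal hK.convex hK.nonempty_interior hy
    obtain ⟨k₀, hk₀, hk₀pos⟩ := exists_coordAt_pos hM hn0
    -- Follow the outer normal from `y` to the first support line it meets. That exit point `y + t •
    -- n` lies on an edge, and its nearest point in `K` is `y`.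
    obtain ⟨k, hk, hmin⟩ := Finset.exists_min_image
      ((Finset.range (2 * M)).filter fun k => 0 < coordAt (θ k) n)
      (fun k => (h k - coordAt (θ k) y) / coordAt (θ k) n)
      ⟨k₀, Finset.mem_filter.2 ⟨hk₀, hk₀pos⟩⟩
    rw [Finset.mem_filter] at hk
    set t := (h k - coordAt (θ k) y) / coordAt (θ k) n with ht
    have ht0 : 0 ≤ t := div_nonneg (sub_nonneg.2 (coordAt_le_supportAt hc _ hyK)) hk.2.le
    have hadd : ∀ φ, coordAt φ (y + t • n) = coordAt φ y + t * coordAt φ n := by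
      intro φ
      simp only [coordAt, PiLp.add_apply, PiLp.smul_apply, smul_eq_mul]; ring
    have hle : ∀ j ∈ Finset.range (2 * M), coordAt (θ j) (y + t • n) ≤ h j := by
      intro j hj
      rw [hadd]
      by_cases hjp : 0 < coordAt (θ j) n
      · have := hmin j (Finset.mem_filter.2 ⟨hj, hjp⟩)
        rw [le_div_iff₀ hjp] at this
        linarith
      · have h1 := mul_nonpos_of_nonneg_of_nonpos ht0 (not_lt.1 hjp)
        have h2 := coordAt_le_supportAt hc (θ j) hyK
        simp only [h]
        linarith
    have heq : coordAt (θ k) (y + t • n) = h k := by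
      rw [hadd, ht, div_mul_cancel₀ _ hk.2.ne']; ring
    have hper : ∀ φ, coordAt (φ + 2 * Real.pi) (y + t • n) = coordAt φ (y + t • n) := by
      intro φ; simp [coordAt]
    have hkM := Finset.mem_range.1 hk.1
    have hnext : coordAt (θ k + δ) (y + t • n) ≤ supportAt K (θ k + δ) := by
      by_cases hlast : k + 1 < 2 * M
      · have := hle (k + 1) (Finset.mem_range.2 hlast)
        have he : θ (k + 1) = θ k + δ := by simp only [θ]; push_cast; ring
        simpa only [h, he] using this
      · have := hle 0 (Finset.mem_range.2 (by omega))
        have he : θ k + δ = θ 0 + 2 * Real.pi := by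
          have : k + 1 = 2 * M := by omega
          have : (k : ℝ) + 1 = 2 * M := by exact_mod_cast this
          simp only [θ]; rw [← hδM]; push_cast; linear_combination δ * this
        rw [he, hper, supportAt_add_two_pi]
        exact this
    have hprev : coordAt (θ k - δ) (y + t • n) ≤ supportAt K (θ k - δ) := by
      rcases Nat.eq_zero_or_pos k with h0 | h0
      · have := hle (2 * M - 1) (Finset.mem_range.2 (by omega))
        have he : θ (2 * M - 1) = θ k - δ + 2 * Real.pi := by
          simp only [θ, h0]; rw [← hδM, Nat.cast_sub (by omega)]; push_cast; ring
        simp only [h, he] at this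
        rwa [hper, supportAt_add_two_pi] at this
      · have := hle (k - 1) (Finset.mem_range.2 (by omega))
        have he : θ (k - 1) = θ k - δ := by
          simp only [θ]; rw [Nat.cast_sub (by omega)]; push_cast; ring
        simpa only [h, he] using this
    obtain ⟨s, hs⟩ := exists_linePoint_eq (θ k) (y + t • n)
    rw [heq] at hs
    rw [← hs, coordAt_linePoint] at hnext hprev
    have e1 : θ k + δ - θ k = δ := by ring
    have e2 : θ k - δ - θ k = -δ := by ring
    rw [e1] at hnext
    rw [e2, Real.cos_neg, Real.sin_neg] at hprev
    refine Set.mem_biUnion (Finset.mem_coe.2 hk.1) ⟨s, ⟨?_, ?_⟩, ?_⟩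
    · rw [div_le_iff₀ hsin]; linarith
    · rw [le_div_iff₀ hsin]; linarith
    · rw [Function.comp_apply, hs]
      refine hp _ y hyK fun w hw => ?_
      rw [add_sub_cancel_left, real_inner_smul_left]
      exact mul_nonpos_of_nonneg_of_nonpos ht0 (hn w hw)
  refine (MeasureTheory.measure_mono hcover).trans
    ((MeasureTheory.measure_biUnion_finset_le _ _).trans (Finset.sum_le_sum fun k _ => ?_))
  have hL : LipschitzWith 1 (p ∘ linePoint (θ k) (h k)) := by
    simpa using hpL.comp (isometry_linePoint (θ k) (h k)).lipschitz
  refine (hL.hausdorffMeasure_image_le zero_le_one _).trans ?_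
  rw [MeasureTheory.hausdorffMeasure_real, Real.volume_Icc]
  simp only [ENNReal.coe_one, ENNReal.one_rpow, one_mul]
  apply le_of_eq
  congr 1
  simp only [lo, hi, h, θ, edgeLength]
  ring

lemma periodic_supportAt (K : Set Plane) {M : ℕ} (hM : 1 ≤ M) :
    Function.Periodic (fun k : ℕ => supportAt K (k * (Real.pi / M))) (2 * M) := by
  intro k
  have hM0 : (0 : ℝ) < M := by exact_mod_cast hM
  have : ((k + 2 * M : ℕ) : ℝ) * (Real.pi / M) = k * (Real.pi / M) + 2 * Real.pi := by
    push_cast; field_simp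
  simp only [this, supportAt_add_two_pi]

/-- By periodicity, the neighbouring support values sum to the same total as the central ones. -/
lemma sum_edgeLength (K : Set Plane) {M : ℕ} (hM : 1 ≤ M) :
    ∑ k ∈ Finset.range (2 * M), edgeLength K (k * (Real.pi / M)) (Real.pi / M) =
      2 * (1 - Real.cos (Real.pi / M)) / Real.sin (Real.pi / M) *
        ∑ k ∈ Finset.range (2 * M), supportAt K (k * (Real.pi / M)) := by
  set δ := Real.pi / M with hδ
  have hM0 : (0 : ℝ) < M := by exact_mod_cast hM
  have hδM : M * δ = Real.pi := by rw [hδ]; field_simp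
  have hper := periodic_supportAt K hM
  have h1 := hper.sum_range_add 1
  have h2 := hper.sum_range_add (2 * M - 1)
  have e1 : ∀ k : ℕ, ((k + 1 : ℕ) : ℝ) * δ = k * δ + δ := fun k => by
    push_cast; ring
  have e2 : ∀ k : ℕ, ((k + (2 * M - 1) : ℕ) : ℝ) * δ = k * δ - δ + 2 * Real.pi :=
    fun k => by
      rw [Nat.cast_add, Nat.cast_sub (by omega), ← hδM]; push_cast; ring
  simp only [← hδ, e1] at h1
  simp only [← hδ, e2, supportAt_add_two_pi] at h2
  simp only [edgeLength, ← Finset.sum_div, Finset.sum_sub_distrib, Finset.sum_add_distrib,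
    ← Finset.mul_sum]
  rw [h1, h2]
  ring

/-! ### Closed polygons inscribed in the curve -/

lemma IsConvexShape.nonempty {K : Set Plane} (hK : IsConvexShape K) : K.Nonempty :=
  hK.nonempty_interior.mono interior_subset

/-- The support function is controlled by the extreme points (Krein-Milman). -/
lemma supportAt_le_of_extremePoints {K : Set Plane} (hK : IsConvexShape K) {θ m : ℝ}
    (h : ∀ x ∈ Set.extremePoints ℝ K, coordAt θ x ≤ m) : supportAt K θ ≤ m := by
  obtain ⟨x, hx, hxθ⟩ := exists_coordAt_eq_supportAt hK.isCompact hK.nonempty θ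
  rw [← hxθ]
  rw [← closure_convexHull_extremePoints hK.isCompact hK.convex] at hx
  exact closure_minimal (convexHull_min h (convex_coordAt_le θ m))
    (isClosed_le (continuous_coordAt θ) continuous_const) hx

/-- A closed polygonal line that reaches the support lines of `K` in all directions `k π / M`
dominates the sum of the support function over these directions. -/
lemma sum_supportAt_mul_sin_le {K : Set Plane} {M : ℕ} (hM : 1 ≤ M) (q : ℕ → Plane) (n : ℕ)
    (hq : ∀ k < 3 * M, ∃ i ≤ n,
      supportAt K (k * (Real.pi / M)) ≤ coordAt (k * (Real.pi / M)) (q i)) :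
    (∑ k ∈ Finset.range (2 * M), supportAt K (k * (Real.pi / M))) *
      (2 * Real.sin (Real.pi / M / 2)) ≤
      ∑ j ∈ Finset.range n, dist (q (j + 1)) (q j) + dist (q n) (q 0) := by
  set δ := Real.pi / M with hδ
  have hM0 : (0 : ℝ) < M := by exact_mod_cast hM
  have hδM : M * δ = Real.pi := by rw [hδ]; field_simp
  have hsin : 0 ≤ Real.sin (δ / 2) := by
    have : δ ≤ Real.pi := div_le_self Real.pi_pos.le (by exact_mod_cast hM)
    exact Real.sin_nonneg_of_nonneg_of_le_pi (by positivity) (by linarith [Real.pi_pos])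
  have hshift : ∀ k : ℕ, ((k + M : ℕ) : ℝ) * δ = k * δ + Real.pi := fun k => by
    rw [← hδM]; push_cast; ring
  -- The width pairs `k` with the opposite direction `k + M`, so indices run up to `3 * M`.
  have hwidth : ∀ k ∈ Finset.range (2 * M),
      2 * (supportAt K (k * δ) + supportAt K ((k + M : ℕ) * δ)) ≤
        ∑ j ∈ Finset.range n, |coordAt (k * δ) (q (j + 1) - q j)| +
          |coordAt (k * δ) (q n - q 0)| := by
    intro k hk
    rw [Finset.mem_range] at hk
    obtain ⟨i, hi, h1⟩ := hq k (by omega)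
    obtain ⟨j, hj, h2⟩ := hq (k + M) (by omega)
    rw [hshift, coordAt_add_pi, ← hshift] at h2
    simp only [coordAt_sub]
    refine le_trans ?_ (two_mul_abs_sub_le_closed_sum (fun l => coordAt (k * δ) (q l)) hi hj)
    have := le_abs_self (coordAt (k * δ) (q i) - coordAt (k * δ) (q j))
    linarith
  have hsum := Finset.sum_le_sum hwidth
  have hper := (periodic_supportAt K hM).sum_range_add M
  simp only [← hδ] at hper
  rw [← Finset.mul_sum, Finset.sum_add_distrib, hper, Finset.sum_add_distrib,
    Finset.sum_comm] at hsum
  have hsum' := mul_le_mul_of_nonneg_right hsum hsin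
  rw [add_mul, Finset.sum_mul] at hsum'
  have h1 := Finset.sum_le_sum fun j (_ : j ∈ Finset.range n) =>
    sum_abs_coordAt_mul_sin_le hM (q (j + 1) - q j)
  have h2 := sum_abs_coordAt_mul_sin_le hM (q n - q 0)
  simp only [← dist_eq_norm, ← hδ] at h1 h2
  rw [← Finset.mul_sum] at h1
  linarith

/-- The loss `1 / cos (δ/2)` is the ratio of `2 tan (δ/2)` to `2 sin (δ/2)`. -/
lemma perimeter_le_of_closed_polygon {K : Set Plane} (hK : IsConvexShape K) {M : ℕ} (hM : 2 ≤ M)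
    {Λ : ℝ} (h : (∑ k ∈ Finset.range (2 * M), supportAt K (k * (Real.pi / M))) *
      (2 * Real.sin (Real.pi / M / 2)) ≤ Λ) :
    perimeter K ≤ ENNReal.ofReal (Λ / Real.cos (Real.pi / M / 2)) := by
  have hM0 : (0 : ℝ) < M := by positivity
  set δ := Real.pi / M with hδ
  have hδ0 : 0 < δ := by positivity
  have hδpi : δ < Real.pi := div_lt_self Real.pi_pos (by exact_mod_cast hM)
  have hsin : 0 < Real.sin δ := Real.sin_pos_of_pos_of_lt_pi hδ0 hδpi
  have hsin2 : 0 < Real.sin (δ / 2) :=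
    Real.sin_pos_of_pos_of_lt_pi (by positivity) (by linarith)
  have hcos2 : 0 < Real.cos (δ / 2) :=
    Real.cos_pos_of_mem_Ioo ⟨by linarith, by linarith⟩
  refine (perimeter_le_sum_edgeLength hK hM).trans ?_
  rw [← ENNReal.ofReal_sum_of_nonneg fun k _ =>
    edgeLength_nonneg hK.isCompact hK.nonempty _ hsin]
  refine ENNReal.ofReal_le_ofReal ?_
  rw [sum_edgeLength K (by omega), ← hδ, le_div_iff₀ hcos2]
  refine le_trans (le_of_eq ?_) h
  have e : δ = 2 * (δ / 2) := by ring
  have h1 : Real.sin δ = 2 * Real.sin (δ / 2) * Real.cos (δ / 2) := by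
    conv_lhs => rw [e]
    exact Real.sin_two_mul _
  have h2 : 1 - Real.cos δ = 2 * Real.sin (δ / 2) ^ 2 := by
    conv_lhs => rw [e]
    rw [Real.cos_two_mul]
    linear_combination -2 * Real.sin_sq_add_cos_sq (δ / 2)
  rw [h1, h2]
  field_simp

lemma perimeter_le_length_add_diam_div_cos {K : Set Plane} (hK : IsConvexShape K)
    {γ : ℝ → Plane} {a b : ℝ} (hγ : IsRectifiableCurve γ a b)
    (hext : Set.extremePoints ℝ K ⊆ γ '' Set.Icc a b) {M : ℕ} (hM : 2 ≤ M) :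
    perimeter K ≤ ENNReal.ofReal
      (((curveLength γ a b).toReal + Metric.diam K) / Real.cos (Real.pi / M / 2)) := by
  -- The curve may leave `K`; only times spent in `K` are used, so that the closing chord is at most
  -- `diam K`.
  let S : Set ℝ := Set.Icc a b ∩ γ ⁻¹' K
  have hScomp : IsCompact S := isCompact_Icc.of_isClosed_subset
    (hγ.continuousOn.preimage_isClosed_of_isClosed isClosed_Icc hK.isCompact.isClosed)
    Set.inter_subset_left
  have hSext : ∀ x ∈ Set.extremePoints ℝ K, ∃ t ∈ S, γ t = x := by
    intro x hx
    obtain ⟨t, ht, rfl⟩ := hext hx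
    exact ⟨t, ⟨ht, hx.1⟩, rfl⟩
  have hSne : S.Nonempty := by
    obtain ⟨x, hx⟩ := hK.isCompact.extremePoints_nonempty hK.nonempty
    obtain ⟨t, ht, -⟩ := hSext x hx
    exact ⟨t, ht⟩
  have hmax : ∀ θ, ∃ t ∈ S, supportAt K θ ≤ coordAt θ (γ t) := by
    intro θ
    obtain ⟨t, ht, hmax⟩ := hScomp.exists_isMaxOn hSne
      ((continuous_coordAt θ).comp_continuousOn (hγ.continuousOn.mono Set.inter_subset_left))
    refine ⟨t, ht, supportAt_le_of_extremePoints hK fun x hx => ?_⟩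
    obtain ⟨s, hs, rfl⟩ := hSext x hx
    exact hmax hs
  choose τ hτS hτ using hmax
  let T : Finset ℝ := (Finset.range (3 * M)).image fun k : ℕ => τ (k * (Real.pi / M))
  have hT : T.Nonempty := by
    simp only [T, Finset.image_nonempty, Finset.nonempty_range_iff]; omega
  have hTS : ∀ t ∈ T, t ∈ S := by
    intro t ht
    obtain ⟨k, -, rfl⟩ := Finset.mem_image.1 ht
    exact hτS _
  obtain ⟨n, u, hu, huT, hTu⟩ := Finset.exists_monotone_enumeration hT
  refine perimeter_le_of_closed_polygon hK hM
    ((sum_supportAt_mul_sin_le (by omega) (fun i => γ (u i)) n ?_).trans (add_le_add ?_ ?_))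
  · intro k hk
    obtain ⟨i, hi, hui⟩ := hTu (τ (k * (Real.pi / M)))
      (Finset.mem_image_of_mem _ (Finset.mem_range.2 hk))
    exact ⟨i, hi, by rw [hui]; exact hτ _⟩
  · have := eVariationOn.sum_le (f := γ) (n := n) hu fun i => (hTS _ (huT i)).1
    rw [← ENNReal.ofReal_le_iff_le_toReal hγ.length_ne_top,
      ENNReal.ofReal_sum_of_nonneg fun _ _ => dist_nonneg]
    simpa only [edist_dist, curveLength] using this
  · exact Metric.dist_le_diam_of_mem hK.isCompact.isBounded (hTS _ (huT n)).2 (hTS _ (huT 0)).2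

/-- A rectifiable curve through all extreme points of a planar convex shape `K` has length at least
`per K - diam K`; the perimeter is finite, so that this is an inequality of real numbers. -/
theorem theorem6 (K : Set Plane) (hK : IsConvexShape K)
    (γ : ℝ → Plane) (a b : ℝ) (hγ : IsRectifiableCurve γ a b)
    (hext : Set.extremePoints ℝ K ⊆ γ '' Set.Icc a b) :
    perimeter K ≠ ∞ ∧
      (curveLength γ a b).toReal ≥ (perimeter K).toReal - Metric.diam K := by
  set Λ := (curveLength γ a b).toReal + Metric.diam K with hΛ
  have hlim : Filter.Tendsto (fun M : ℕ => ENNReal.ofReal (Λ / Real.cos (Real.pi / M / 2)))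
      Filter.atTop (nhds (ENNReal.ofReal Λ)) := by
    refine ENNReal.tendsto_ofReal ?_
    have h0 : Filter.Tendsto (fun M : ℕ => Real.pi / (M : ℝ) / 2) Filter.atTop (nhds 0) := by
      simpa using (tendsto_const_div_atTop_nhds_zero_nat Real.pi).div_const 2
    have h1 := (Real.continuous_cos.tendsto 0).comp h0
    rw [Real.cos_zero] at h1
    have h2 := (tendsto_const_nhds (x := Λ)).div h1 one_ne_zero
    rwa [div_one] at h2
  have hle : perimeter K ≤ ENNReal.ofReal Λ :=
    ge_of_tendsto hlim (Filter.eventually_atTop.2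
      ⟨2, fun M hM => perimeter_le_length_add_diam_div_cos hK hγ hext hM⟩)
  have hΛ0 : 0 ≤ Λ := add_nonneg ENNReal.toReal_nonneg Metric.diam_nonneg
  refine ⟨ne_top_of_le_ne_top ENNReal.ofReal_ne_top hle, ?_⟩
  have := ENNReal.toReal_le_of_le_ofReal hΛ0 hle
  linarith
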